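/- Let $w$ be a real, measurable kernel on $[0,1]^2$ that is symmetric, $w(u,v)=w(v,u)$ for almost every $(u,v)$, and square-integrable, $\int_0^1\int_0^1 w^2(u,v)\,du\,dv<\infty$. Let $T_w f(u)=\int_0^1 w(u,v)f(v)\,dv$ be its integral operator on $L^2[0,1]$, let $1$ denote the constant function, and let $\xi$ be uniform on $[0,1]$. Suppose that every nonzero eigenvalue of $T_w$ has multiplicity one and that its eigenfunctions $\phi$ satisfy $\int_0^1\phi(u)\,du\neq 0$. Call $w$ canonical if, off a null set of $u\in[0,1]$, the sequence $(T_w(1)(u),T_w^2(1)(u),T_w^3(1)(u),\dots)$ is nondecreasing in $u$ for the lexicographic order; that is, $T_w(1)(u)=\int_0^1 w(u,v)\,dv$ is nondecreasing, points $u$ with the same value of $T_w(1)$ are ordered by $T_w^2(1)$, remaining ties by $T_w^3(1)$, and so on. Then the joint distribution of $(T_w(1)(\xi),T_w^2(1)(\xi),\dots)$ determines, and is determined by, the canonical $w$. Precisely, let $w_1$ and $w_2$ both satisfy the assumptions above (being canonical is required in (a) only). (a) If $w_1$ and $w_2$ are canonical, then $(T_{w_1}^k(1)(\xi))_{k\ge1}$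 and $(T_{w_2}^k(1)(\xi))_{k\ge1}$ have the same joint distribution if and only if $w_1=w_2$ almost everywhere on $[0,1]^2$. (b) Whether or not $w_1$ and $w_2$ are canonical, these joint distributions are equal if and only if $w_1$ and $w_2$ agree up to measure-preserving transformations, that is, there are measure-preserving maps $\sigma_1,\sigma_2:[0,1]\to[0,1]$ with $w_1(\sigma_1(u),\sigma_1(v))=w_2(\sigma_2(u),\sigma_2(v))$ for almost every $(u,v)\in[0,1]^2$. -/

import Mathlib

open MeasureTheory unitInterval

namespace Graphon

/-- The integral operator `T_w f (u) = ∫₀¹ w(u,v) f(v) dv` with kernel `w` on `[0,1]`. -/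
noncomputable def T (w : I → I → ℝ) (f : I → ℝ) : I → ℝ :=
  fun u => ∫ v, w u v * f v

/-- A symmetric, square-integrable kernel on `[0,1]²`. -/
structure IsL2Kernel (w : I → I → ℝ) : Prop where
  symm : ∀ᵐ p : I × I, w p.1 p.2 = w p.2 p.1
  memLp : MemLp (fun p : I × I => w p.1 p.2) 2

/-- `φ` is an `L²` eigenfunction of `T_w` with eigenvalue `c`. -/
structure IsEigenfunction (w : I → I → ℝ) (c : ℝ) (φ : I → ℝ) : Prop where
  memLp : MemLp φ 2
  ne_zero : ¬ φ =ᵐ[volume] 0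
  eq : T w φ =ᵐ[volume] fun u => c * φ u

/-- Every nonzero eigenvalue of `T_w` has multiplicity one, and its eigenfunctions have nonzero
integral. -/
structure HasSimpleNonorthogonalSpectrum (w : I → I → ℝ) : Prop where
  simple : ∀ (c : ℝ) (φ ψ : I → ℝ), c ≠ 0 → IsEigenfunction w c φ → IsEigenfunction w c ψ →
    ∃ a : ℝ, ψ =ᵐ[volume] fun u => a * φ u
  integral_ne_zero : ∀ (c : ℝ) (φ : I → ℝ), c ≠ 0 → IsEigenfunction w c φ → ∫ u, φ u ≠ 0

/-- The sequence `(T_w(1)(u), T_w²(1)(u), …)`; the entry with index `k` is `T_w^(k+1)(1)(u)`. -/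
noncomputable def iterates (w : I → I → ℝ) (u : I) : ℕ → ℝ :=
  fun k => (T w)^[k + 1] (fun _ => 1) u

/-- The joint distribution of `(T_w(1)(ξ), T_w²(1)(ξ), …)` for `ξ` uniform on `[0,1]`. -/
noncomputable def iteratesLaw (w : I → I → ℝ) : Measure (ℕ → ℝ) :=
  (volume : Measure I).map (iterates w)

/-- `w₁` and `w₂` are the same kernel up to measure-preserving transformations of `[0,1]`. -/
def Equivalent (w₁ w₂ : I → I → ℝ) : Prop :=
  ∃ σ₁ σ₂ : I → I, MeasurePreserving σ₁ ∧ MeasurePreserving σ₂ ∧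
    ∀ᵐ p : I × I, w₁ (σ₁ p.1) (σ₁ p.2) = w₂ (σ₂ p.1) (σ₂ p.2)

/-- `w` is canonical: off a null set, `T_w(1)(u) = ∫₀¹ w(u,v) dv` is nondecreasing in `u`, points
with equal `T_w(1)` are ordered by `T_w²(1)`, remaining ties by `T_w³(1)`, and so on. -/
def IsCanonical (w : I → I → ℝ) : Prop :=
  ∃ S : Set I, volume Sᶜ = 0 ∧ MonotoneOn (fun u => toLex (iterates w u)) S

end Graphon

/-! The sequence `T_w^k 1`, `k ≥ 1`, taken as functions on `[0,1]`, determines `w`. The operator is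
compact and self-adjoint, and the orthogonal complement of this orbit is invariant. An eigenvector
`φ` there with eigenvalue `c ≠ 0` would satisfy `c⟪φ, 1⟫ = ⟪φ, T_w 1⟫ = 0`, against the nonzero
integral; so `T_w` vanishes on the complement (`VanishesOffOrbit.of_eigenvectors`). Two such
operators with the same orbit agree on its closed span and both vanish off it, and an operator
determines its kernel (`ae_eq_of_iterates_ae_eq`).

It remains to turn equality in law into equality almost everywhere. For (b), a coupling supplies
`τ₁`, `τ₂` along which the two sequences agree (`exists_measurePreserving_comp_eq`). Pulling a
kernel back along `τ` composes its iterates with `τ` and preserves vanishing off the orbit, so the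
pulled-back kernels coincide. For (a), a nondecreasing map from `[0,1]` to a linear order is
determined by its law (`ae_eq_of_monotoneOn`), here for the lexicographic order. -/

namespace Graphon

/-! ### Hilbert–Schmidt operators: definition by duality, injectivity, compactness. -/

section HilbertSchmidt

open scoped InnerProductSpace

variable {α : Type*} [MeasurableSpace α] {μ : Measure α}

theorem memLp_two_mul_prod [SFinite μ] {f g : α → ℝ} (hf : MemLp f 2 μ) (hg : MemLp g 2 μ) :
    MemLp (fun p : α × α => f p.1 * g p.2) 2 (μ.prod μ) := by
  have hm : AEStronglyMeasurable (fun p : α × α => f p.1 * g p.2) (μ.prod μ) :=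
    hf.1.comp_fst.mul hg.1.comp_snd
  rw [memLp_two_iff_integrable_sq hm]
  simpa only [mul_pow] using hf.integrable_sq.mul_prod hg.integrable_sq

theorem ae_fst [SFinite μ] {p : α → Prop} (h : ∀ᵐ x ∂μ, p x) : ∀ᵐ z ∂μ.prod μ, p z.1 :=
  Measure.quasiMeasurePreserving_fst.ae h

theorem ae_snd [SFinite μ] {p : α → Prop} (h : ∀ᵐ x ∂μ, p x) : ∀ᵐ z ∂μ.prod μ, p z.2 :=
  Measure.quasiMeasurePreserving_snd.ae h

variable [IsFiniteMeasure μ]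

/-- The function `(u, v) ↦ f u * g v` as an element of `L²`. -/
noncomputable def tensorLp (f g : Lp ℝ 2 μ) : Lp ℝ 2 (μ.prod μ) :=
  (memLp_two_mul_prod (Lp.memLp f) (Lp.memLp g)).toLp _

theorem coeFn_tensorLp (f g : Lp ℝ 2 μ) :
    tensorLp f g =ᵐ[μ.prod μ] fun p => f p.1 * g p.2 :=
  MemLp.coeFn_toLp _

theorem inner_tensorLp (f g f' g' : Lp ℝ 2 μ) :
    ⟪tensorLp f g, tensorLp f' g'⟫_ℝ = ⟪f, f'⟫_ℝ * ⟪g, g'⟫_ℝ := by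
  simp only [L2.inner_def]
  rw [← integral_prod_mul]
  refine integral_congr_ae ?_
  filter_upwards [coeFn_tensorLp f g, coeFn_tensorLp f' g'] with p h1 h2
  simp only [h1, h2, RCLike.inner_apply]
  simp
  ring

theorem norm_tensorLp (f g : Lp ℝ 2 μ) : ‖tensorLp f g‖ = ‖f‖ * ‖g‖ := by
  rw [← sq_eq_sq₀ (norm_nonneg _) (by positivity), ← real_inner_self_eq_norm_sq, inner_tensorLp,
    real_inner_self_eq_norm_sq, real_inner_self_eq_norm_sq]
  ring

/-- The tensor product `f ↦ g ↦ (g ⊗ f)` as a bounded bilinear map. -/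
noncomputable def tensorCLM : Lp ℝ 2 μ →L[ℝ] Lp ℝ 2 μ →L[ℝ] Lp ℝ 2 (μ.prod μ) :=
  LinearMap.mkContinuous₂
    (LinearMap.mk₂ ℝ (fun f g => tensorLp g f)
      (fun f f' g => by
        ext1
        filter_upwards [coeFn_tensorLp g (f + f'), coeFn_tensorLp g f, coeFn_tensorLp g f',
          Lp.coeFn_add (tensorLp g f) (tensorLp g f'), ae_snd (Lp.coeFn_add f f')]
          with p h1 h2 h3 h4 h5
        rw [h1, h4, h5, Pi.add_apply, Pi.add_apply, h2, h3]
        ring)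
      (fun c f g => by
        ext1
        filter_upwards [coeFn_tensorLp g (c • f), coeFn_tensorLp g f,
          Lp.coeFn_smul c (tensorLp g f), ae_snd (Lp.coeFn_smul c f)] with p h1 h2 h4 h5
        rw [h1, h4, h5, Pi.smul_apply, Pi.smul_apply, h2, smul_eq_mul, smul_eq_mul]
        ring)
      (fun f g g' => by
        ext1
        filter_upwards [coeFn_tensorLp (g + g') f, coeFn_tensorLp g f, coeFn_tensorLp g' f,
          Lp.coeFn_add (tensorLp g f) (tensorLp g' f), ae_fst (Lp.coeFn_add g g')]
          with p h1 h2 h3 h4 h5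
        rw [h1, h4, h5, Pi.add_apply, Pi.add_apply, h2, h3]
        ring)
      (fun c f g => by
        ext1
        filter_upwards [coeFn_tensorLp (c • g) f, coeFn_tensorLp g f,
          Lp.coeFn_smul c (tensorLp g f), ae_fst (Lp.coeFn_smul c g)] with p h1 h2 h4 h5
        rw [h1, h4, h5, Pi.smul_apply, Pi.smul_apply, h2, smul_eq_mul, smul_eq_mul]
        ring))
    1 (fun f g => by
      rw [LinearMap.mk₂_apply, norm_tensorLp, one_mul, mul_comm])

theorem tensorCLM_apply (f g : Lp ℝ 2 μ) : tensorCLM f g = tensorLp g f := rfl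

theorem norm_tensorCLM_apply_le (f : Lp ℝ 2 μ) : ‖tensorCLM f‖ ≤ ‖f‖ :=
  ContinuousLinearMap.opNorm_le_bound _ (norm_nonneg _) fun g => by
    rw [tensorCLM_apply, norm_tensorLp, mul_comm]

/-- The Hilbert–Schmidt operator with kernel `k`. -/
noncomputable def hilbertSchmidt :
    Lp ℝ 2 (μ.prod μ) →L[ℝ] Lp ℝ 2 μ →L[ℝ] Lp ℝ 2 μ :=
  LinearMap.mkContinuous₂
    (LinearMap.mk₂ ℝ (fun k f => ContinuousLinearMap.adjoint (tensorCLM f) k)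
      (fun _ _ _ => map_add _ _ _) (fun _ _ _ => map_smul _ _ _)
      (fun k f f' => by simp only [map_add, _root_.add_apply])
      (fun c k f => by
        refine ext_inner_right ℝ fun g => ?_
        simp only [ContinuousLinearMap.adjoint_inner_left, map_smul,
          _root_.smul_apply, inner_smul_left]))
    1 (fun k f => by
      rw [LinearMap.mk₂_apply, one_mul, mul_comm]
      refine (ContinuousLinearMap.le_opNorm _ _).trans ?_
      rw [LinearIsometryEquiv.norm_map]
      gcongr
      exact norm_tensorCLM_apply_le f)

/-- The weak form of the integral formula; operator arguments use it in place of pointwise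
integrals. -/
theorem inner_hilbertSchmidt (k : Lp ℝ 2 (μ.prod μ)) (f g : Lp ℝ 2 μ) :
    ⟪hilbertSchmidt k f, g⟫_ℝ = ⟪k, tensorLp g f⟫_ℝ := by
  rw [hilbertSchmidt, LinearMap.mkContinuous₂_apply, LinearMap.mk₂_apply,
    ContinuousLinearMap.adjoint_inner_left, tensorCLM_apply]

theorem hilbertSchmidt_tensorLp (a b f : Lp ℝ 2 μ) :
    hilbertSchmidt (tensorLp a b) f = ⟪b, f⟫_ℝ • a := by
  refine ext_inner_right ℝ fun g => ?_
  rw [inner_hilbertSchmidt, inner_tensorLp, inner_smul_left, mul_comm]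
  rfl

/-- Indicators of rectangles are tensors, and rectangles form a π-system generating the product
σ-algebra, so `k` has zero integral over every measurable set. -/
theorem eq_zero_of_forall_inner_tensorLp_eq_zero (k : Lp ℝ 2 (μ.prod μ))
    (h : ∀ f g : Lp ℝ 2 μ, ⟪tensorLp f g, k⟫_ℝ = 0) : k = 0 := by
  have hint : Integrable k (μ.prod μ) := (Lp.memLp k).integrable (by norm_num)
  have key : ∀ s : Set (α × α), MeasurableSet s → ∫ p in s, k p ∂μ.prod μ = 0 := by
    refine MeasurableSpace.induction_on_inter generateFrom_prod.symm isPiSystem_prod ?_ ?_ ?_ ?_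
    · simp
    · rintro _ ⟨s, hs, t, ht, rfl⟩
      rw [← h (indicatorConstLp 2 hs (measure_ne_top μ s) 1)
        (indicatorConstLp 2 ht (measure_ne_top μ t) 1), L2.inner_def,
        ← integral_indicator (hs.prod ht)]
      refine integral_congr_ae ?_
      filter_upwards [coeFn_tensorLp (indicatorConstLp 2 hs (measure_ne_top μ s) (1 : ℝ))
        (indicatorConstLp 2 ht (measure_ne_top μ t) 1),
        ae_fst (indicatorConstLp_coeFn (p := 2) (hs := hs) (hμs := measure_ne_top μ s)
          (c := (1 : ℝ))),
        ae_snd (indicatorConstLp_coeFn (p := 2) (hs := ht) (hμs := measure_ne_top μ t)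
          (c := (1 : ℝ)))] with p h1 h2 h3
      rw [h1, h2, h3]
      by_cases hp1 : p.1 ∈ s <;> by_cases hp2 : p.2 ∈ t <;>
        simp [Set.indicator, hp1, hp2]
    · intro s hs ih
      have := integral_add_compl hs hint
      have huniv : ∫ p, k p ∂μ.prod μ = 0 := by
        rw [← h (indicatorConstLp 2 MeasurableSet.univ (measure_ne_top μ _) 1)
          (indicatorConstLp 2 MeasurableSet.univ (measure_ne_top μ _) 1), L2.inner_def]
        refine integral_congr_ae ?_
        have h0 := indicatorConstLp_coeFn (p := 2) (hs := MeasurableSet.univ)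
          (hμs := measure_ne_top μ _) (c := (1 : ℝ))
        filter_upwards [coeFn_tensorLp
          (indicatorConstLp 2 MeasurableSet.univ (measure_ne_top μ _) (1 : ℝ))
          (indicatorConstLp 2 MeasurableSet.univ (measure_ne_top μ _) 1),
          ae_fst h0, ae_snd h0] with p h1 h2 h3
        rw [h1, h2, h3]
        simp
      rw [ih, huniv, zero_add] at this
      exact this
    · intro s hd hs ih
      rw [integral_iUnion hs hd hint.integrableOn]
      simp [ih]
  have := Integrable.ae_eq_of_forall_setIntegral_eq k 0 hint (integrable_zero _ _ _)
    (fun s hs _ => by simpa using key s hs)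
  exact Lp.ext (this.trans (Lp.coeFn_zero _ _ _).symm)

theorem hilbertSchmidt_injective :
    Function.Injective (hilbertSchmidt : Lp ℝ 2 (μ.prod μ) →L[ℝ] Lp ℝ 2 μ →L[ℝ] Lp ℝ 2 μ) := by
  rw [injective_iff_map_eq_zero]
  intro k hk
  refine eq_zero_of_forall_inner_tensorLp_eq_zero k fun f g => ?_
  rw [real_inner_comm, ← inner_hilbertSchmidt, hk]
  simp

/-- Tensors give rank-one operators and span a dense subspace; compact operators form a closed
subspace. -/
theorem isCompactOperator_hilbertSchmidt (k : Lp ℝ 2 (μ.prod μ)) :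
    IsCompactOperator (hilbertSchmidt k) := by
  let V : Submodule ℝ (Lp ℝ 2 (μ.prod μ)) :=
    (compactOperator (RingHom.id ℝ) (Lp ℝ 2 μ) (Lp ℝ 2 μ)).comap
      (hilbertSchmidt (μ := μ)).toLinearMap
  have hVmem : ∀ k, k ∈ V ↔ IsCompactOperator (hilbertSchmidt k) := fun k => Iff.rfl
  have hcl : IsClosed (V : Set (Lp ℝ 2 (μ.prod μ))) :=
    (isClosed_setOfPred_isCompactOperator (σ₁₂ := RingHom.id ℝ)).preimage
      (hilbertSchmidt (μ := μ)).continuous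
  have : V = ⊤ := by
    rw [← hcl.submodule_topologicalClosure_eq, Submodule.topologicalClosure_eq_top_iff,
      Submodule.eq_bot_iff]
    intro k hk
    refine eq_zero_of_forall_inner_tensorLp_eq_zero k fun f g => hk _ ?_
    rw [hVmem]
    have hfg : (hilbertSchmidt (tensorLp f g)) =
        (ContinuousLinearMap.toSpanSingleton ℝ f).comp (innerSL ℝ g) := by
      ext1 h
      rw [hilbertSchmidt_tensorLp]
      simp
    rw [hfg]
    exact (isCompactOperator_of_locallyCompactSpace_rng
      (ContinuousLinearMap.toSpanSingleton ℝ f)).comp_clm _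
  rw [← hVmem, this]
  trivial

end HilbertSchmidt

end Graphon

namespace Graphon

open scoped InnerProductSpace

/-! ### Operators determined by the orbit of one vector. -/

section Operators

variable {H : Type*} [NormedAddCommGroup H] [InnerProductSpace ℝ H]

/-- `T` vanishes on the orthogonal complement of the vectors `T e, T² e, …`. -/
def VanishesOffOrbit (T : H →L[ℝ] H) (e : H) : Prop :=
  ∀ f, (∀ k : ℕ, ⟪f, T^[k] (T e)⟫_ℝ = 0) → T f = 0

theorem VanishesOffOrbit.of_eigenvectors [CompleteSpace H] {T : H →L[ℝ] H} {e : H}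
    (hc : IsCompactOperator T) (hT : (T : H →ₗ[ℝ] H).IsSymmetric)
    (h : ∀ (c : ℝ) (φ : H), c ≠ 0 → φ ≠ 0 → T φ = c • φ → ⟪φ, e⟫_ℝ ≠ 0) :
    VanishesOffOrbit T e := by
  let W : Submodule ℝ H := ⨅ k : ℕ, (ℝ ∙ (T^[k] (T e)))ᗮ
  have hW : ∀ f, f ∈ W ↔ ∀ k : ℕ, ⟪f, T^[k] (T e)⟫_ℝ = 0 := fun f => by
    simp only [W, Submodule.mem_iInf, Submodule.mem_orthogonal_singleton_iff_inner_left]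
  have hcl : IsClosed (W : Set H) := by
    simp only [W, Submodule.coe_iInf]
    exact isClosed_iInter fun k => Submodule.isClosed_orthogonal _
  have hinv : ∀ f ∈ W, T f ∈ W := fun f hf => by
    rw [hW] at hf ⊢
    intro k
    have := hT f (T^[k] (T e))
    simp only [ContinuousLinearMap.coe_coe] at this
    rw [this, ← Function.iterate_succ_apply' T]
    exact hf (k + 1)
  have : CompleteSpace W := hcl.completeSpace_coe
  let S : W →L[ℝ] W := T.restrict hinv
  have hSc : IsCompactOperator S := hc.restrict' hinv
  have hSs : (S : W →ₗ[ℝ] W).IsSymmetric := hT.restrict_invariant hinv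
  -- A compact self-adjoint operator with no nonzero eigenvalue is zero.
  have hS : S = 0 := by
    rw [← ContinuousLinearMap.eq_zero_of_forall_hasEigenvalue_eq_zero hSc hSs]
    intro c hev
    by_contra hc0
    obtain ⟨φ, hφ⟩ := hev.exists_hasEigenvector
    have h1 : T φ = c • (φ : H) := congrArg Subtype.val hφ.apply_eq_smul
    have h2 : (φ : H) ≠ 0 := fun h0 => hφ.2 (Subtype.ext h0)
    refine h c φ hc0 h2 h1 ?_
    have h3 := (hW φ).1 φ.2 0
    have h4 := hT φ e
    simp only [ContinuousLinearMap.coe_coe] at h4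
    rw [Function.iterate_zero_apply, ← h4, h1, inner_smul_left] at h3
    exact (mul_eq_zero.1 h3).resolve_left (by simpa using hc0)
  intro f hf
  have := congrArg (fun A : W →L[ℝ] W => ((A ⟨f, (hW f).2 hf⟩ : W) : H)) hS
  exact this

/-- Both operators shift the common orbit, so they agree on its closed span `V`; both vanish on
`Vᗮ`. The vector `e` need not lie in `V`. -/
theorem VanishesOffOrbit.eq_of_orbit_eq [CompleteSpace H] {T₁ T₂ : H →L[ℝ] H} {e : H}
    (h₁ : VanishesOffOrbit T₁ e) (h₂ : VanishesOffOrbit T₂ e)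
    (h : ∀ k : ℕ, T₁^[k] (T₁ e) = T₂^[k] (T₂ e)) : T₁ = T₂ := by
  let V : Submodule ℝ H := (Submodule.span ℝ (Set.range fun k : ℕ => T₁^[k] (T₁ e))).topologicalClosure
  have hV : V ≤ LinearMap.eqLocus (T₁ : H →ₗ[ℝ] H) (T₂ : H →ₗ[ℝ] H) := by
    refine Submodule.topologicalClosure_minimal _ (Submodule.span_le.2 ?_)
      (isClosed_eq T₁.continuous T₂.continuous)
    rintro _ ⟨k, rfl⟩
    change T₁ (T₁^[k] (T₁ e)) = T₂ (T₁^[k] (T₁ e))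
    have h' := h (k + 1)
    rw [Function.iterate_succ_apply', Function.iterate_succ_apply'] at h'
    rw [h', h k]
  have : CompleteSpace V :=
    (Submodule.isClosed_topologicalClosure _).completeSpace_coe
  have hmem : ∀ k : ℕ, T₁^[k] (T₁ e) ∈ V := fun k =>
    Submodule.le_topologicalClosure _ (Submodule.subset_span ⟨k, rfl⟩)
  ext1 f
  obtain ⟨g, hg, r, hr, rfl⟩ := V.exists_add_mem_mem_orthogonal f
  have hr' : ∀ k, ⟪r, T₁^[k] (T₁ e)⟫_ℝ = 0 := fun k =>
    (Submodule.mem_orthogonal' V r).1 hr _ (hmem k)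
  rw [map_add, map_add, h₁ r hr', h₂ r fun k => by rw [← h k]; exact hr' k]
  congr 1
  exact hV hg

variable {H' : Type*} [NormedAddCommGroup H'] [InnerProductSpace ℝ H'] [CompleteSpace H]
  [CompleteSpace H']

/-- Only `C* C = 1` is needed to cancel inner factors; `C` need not be onto. -/
theorem iterate_conj_isometry (T : H →L[ℝ] H) (C : H →ₗᵢ[ℝ] H') (e : H) (k : ℕ) :
    (C.toContinuousLinearMap ∘L T ∘L C.toContinuousLinearMap.adjoint)^[k]
      ((C.toContinuousLinearMap ∘L T ∘L C.toContinuousLinearMap.adjoint) (C e)) =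
      C (T^[k] (T e)) := by
  have hC : ∀ x, C.toContinuousLinearMap.adjoint (C x) = x := fun x =>
    ext_inner_right ℝ fun y => by
      rw [ContinuousLinearMap.adjoint_inner_left]
      exact C.inner_map_map x y
  induction k with
  | zero => simp [hC]
  | succ k ih =>
    rw [Function.iterate_succ_apply', ih, Function.iterate_succ_apply']
    simp [hC]

/-- Lets pulled-back kernels inherit the property without a study of their spectra. -/
theorem VanishesOffOrbit.conj_isometry {T : H →L[ℝ] H} {e : H} (h : VanishesOffOrbit T e)
    (C : H →ₗᵢ[ℝ] H') :
    VanishesOffOrbit (C.toContinuousLinearMap ∘L T ∘L C.toContinuousLinearMap.adjoint) (C e) := by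
  intro f hf
  have : T (C.toContinuousLinearMap.adjoint f) = 0 := h _ fun k => by
    rw [ContinuousLinearMap.adjoint_inner_left, ← hf k, iterate_conj_isometry]
    rfl
  simp [this]

end Operators

/-! ### Pullback of kernels as conjugation by the composition isometry. -/

section Pullback

variable {α : Type*} [MeasurableSpace α] {μ : Measure α} [IsFiniteMeasure μ]

theorem tensorLp_compMeasurePreserving {τ : α → α} (hτ : MeasurePreserving τ μ μ)
    (f g : Lp ℝ 2 μ) :
    Lp.compMeasurePreserving (Prod.map τ τ) (hτ.prod hτ) (tensorLp f g) =
      tensorLp (Lp.compMeasurePreserving τ hτ f) (Lp.compMeasurePreserving τ hτ g) := by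
  ext1
  filter_upwards [Lp.coeFn_compMeasurePreserving (tensorLp f g) (hτ.prod hτ),
    (hτ.prod hτ).quasiMeasurePreserving.ae (coeFn_tensorLp f g),
    coeFn_tensorLp (Lp.compMeasurePreserving τ hτ f) (Lp.compMeasurePreserving τ hτ g),
    ae_fst (Lp.coeFn_compMeasurePreserving f hτ), ae_snd (Lp.coeFn_compMeasurePreserving g hτ)]
    with p h1 h2 h3 h4 h5
  rw [h1, h3, h4, h5, Function.comp_apply, h2]
  rfl

/-- Pulling back the kernel along `τ` conjugates the operator by the composition isometry. -/
theorem hilbertSchmidt_compMeasurePreserving {τ : α → α} (hτ : MeasurePreserving τ μ μ)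
    (k : Lp ℝ 2 (μ.prod μ)) :
    hilbertSchmidt (Lp.compMeasurePreserving (Prod.map τ τ) (hτ.prod hτ) k) =
      (Lp.compMeasurePreservingₗᵢ ℝ τ hτ).toContinuousLinearMap ∘L hilbertSchmidt k ∘L
        (Lp.compMeasurePreservingₗᵢ (E := ℝ) (p := 2) ℝ τ hτ).toContinuousLinearMap.adjoint := by
  set C := Lp.compMeasurePreservingₗᵢ (E := ℝ) (p := 2) ℝ τ hτ
  set C₂ := Lp.compMeasurePreservingₗᵢ (E := ℝ) (p := 2) ℝ (Prod.map τ τ) (hτ.prod hτ)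
  -- By duality, the claim reduces to the adjoint of composition on the square acting factorwise on
  -- tensors.
  have key : ∀ f g : Lp ℝ 2 μ, C₂.toContinuousLinearMap.adjoint (tensorLp g f) =
      tensorLp (C.toContinuousLinearMap.adjoint g) (C.toContinuousLinearMap.adjoint f) := by
    intro f g
    rw [← sub_eq_zero]
    refine eq_zero_of_forall_inner_tensorLp_eq_zero _ fun a b => ?_
    have h1 : C₂.toContinuousLinearMap (tensorLp a b) = tensorLp (C a) (C b) :=
      tensorLp_compMeasurePreserving hτ a b
    rw [inner_sub_right, ContinuousLinearMap.adjoint_inner_right, h1, inner_tensorLp,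
      inner_tensorLp, ContinuousLinearMap.adjoint_inner_right,
      ContinuousLinearMap.adjoint_inner_right]
    exact sub_self _
  ext1 f
  refine ext_inner_right ℝ fun g => ?_
  rw [inner_hilbertSchmidt, ContinuousLinearMap.comp_apply, ContinuousLinearMap.comp_apply,
    ← ContinuousLinearMap.adjoint_inner_right, inner_hilbertSchmidt, ← key,
    ContinuousLinearMap.adjoint_inner_right]
  rfl

end Pullback

end Graphon

namespace Graphon

open scoped InnerProductSpace

/-! ### From pointwise kernels and iterates to `L²` operators. -/

section KernelOperator

/-- A square-integrable kernel as an element of `L²`. -/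
noncomputable def kernelLp {w : I → I → ℝ} (hw : MemLp (fun p : I × I => w p.1 p.2) 2) :
    Lp ℝ 2 ((volume : Measure I).prod (volume : Measure I)) :=
  hw.toLp _

theorem coeFn_kernelLp {w : I → I → ℝ} (hw : MemLp (fun p : I × I => w p.1 p.2) 2) :
    kernelLp hw =ᵐ[(volume : Measure I).prod volume] fun p => w p.1 p.2 :=
  hw.coeFn_toLp

/-- The constant function `1` as an element of `L²`. -/
noncomputable def oneLp : Lp ℝ 2 (volume : Measure I) := Lp.const 2 volume 1

theorem coeFn_oneLp : oneLp =ᵐ[volume] fun _ => (1 : ℝ) := Lp.coeFn_const 2 volume 1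

theorem T_congr (w : I → I → ℝ) {f g : I → ℝ} (h : f =ᵐ[volume] g) : T w f = T w g := by
  funext u
  refine integral_congr_ae ?_
  filter_upwards [h] with v hv
  rw [hv]

/-- Over any measurable `s`, both sides integrate to the inner product of the kernel with `1_s ⊗ f`.
-/
theorem T_ae_eq_hilbertSchmidt {w : I → I → ℝ} (hw : MemLp (fun p : I × I => w p.1 p.2) 2)
    (f : Lp ℝ 2 (volume : Measure I)) :
    T w f =ᵐ[volume] hilbertSchmidt (kernelLp hw) f := by
  have hsnd : MemLp (fun p : I × I => f p.2) 2 ((volume : Measure I).prod volume) :=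
    (Lp.memLp f).comp_measurePreserving measurePreserving_snd
  have hint : Integrable (fun p : I × I => w p.1 p.2 * f p.2) ((volume : Measure I).prod volume) :=
    hw.integrable_mul hsnd
  refine Integrable.ae_eq_of_forall_setIntegral_eq _ _ hint.integral_prod_left
    ((Lp.memLp _).integrable (by norm_num)) fun s hs _ => ?_
  have h1 : ∫ x in s, hilbertSchmidt (kernelLp hw) f x =
      ⟪kernelLp hw, tensorLp (indicatorConstLp 2 hs (measure_ne_top volume s) 1) f⟫_ℝ := by
    rw [← inner_hilbertSchmidt, real_inner_comm, L2.inner_indicatorConstLp_one]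
  rw [h1, L2.inner_def]
  have h2 : ∫ x in s, T w f x = ∫ p in s ×ˢ Set.univ, w p.1 p.2 * f p.2
      ∂((volume : Measure I).prod volume) := by
    rw [setIntegral_prod _ hint.integrableOn]
    simp [T]
  rw [h2, ← integral_indicator (hs.prod MeasurableSet.univ)]
  refine integral_congr_ae ?_
  filter_upwards [coeFn_kernelLp hw, coeFn_tensorLp
    (indicatorConstLp 2 hs (measure_ne_top volume s) 1) f,
    ae_fst (indicatorConstLp_coeFn (p := 2) (hs := hs) (hμs := measure_ne_top volume s)
      (c := (1 : ℝ)))] with p h1 h2 h3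
  rw [h1, h2, h3]
  by_cases hp1 : p.1 ∈ s <;> simp [Set.indicator, hp1, mul_comm]

theorem iterates_ae_eq {w : I → I → ℝ} (hw : MemLp (fun p : I × I => w p.1 p.2) 2) (k : ℕ) :
    (fun u => iterates w u k) =ᵐ[volume]
      ((hilbertSchmidt (kernelLp hw))^[k] (hilbertSchmidt (kernelLp hw) oneLp) :
        Lp ℝ 2 (volume : Measure I)) := by
  change (T w)^[k + 1] (fun _ => 1) =ᵐ[volume] _
  induction k with
  | zero =>
    rw [Function.iterate_succ_apply', Function.iterate_zero_apply, Function.iterate_zero_apply,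
      ← T_congr w coeFn_oneLp]
    exact T_ae_eq_hilbertSchmidt hw _
  | succ k ih =>
    rw [Function.iterate_succ_apply', Function.iterate_succ_apply' (hilbertSchmidt _),
      T_congr w ih]
    exact T_ae_eq_hilbertSchmidt hw _

theorem aemeasurable_iterates {w : I → I → ℝ} (hw : MemLp (fun p : I × I => w p.1 p.2) 2) :
    AEMeasurable (iterates w) volume :=
  aemeasurable_pi_iff.2 fun k =>
    (Lp.aestronglyMeasurable _).aemeasurable.congr (iterates_ae_eq hw k).symm

theorem isSymmetric_hilbertSchmidt {w : I → I → ℝ} (hw : IsL2Kernel w) :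
    (hilbertSchmidt (kernelLp hw.memLp) : Lp ℝ 2 (volume : Measure I) →ₗ[ℝ] _).IsSymmetric := by
  intro f g
  rw [ContinuousLinearMap.coe_coe, real_inner_comm _ f, inner_hilbertSchmidt,
    inner_hilbertSchmidt, L2.inner_def, L2.inner_def, ← integral_prod_swap]
  refine integral_congr_ae ?_
  have hq := (Measure.measurePreserving_swap (μ := (volume : Measure I))
    (ν := (volume : Measure I))).quasiMeasurePreserving
  filter_upwards [coeFn_kernelLp hw.memLp, hq.ae (coeFn_kernelLp hw.memLp), hw.symm,
    coeFn_tensorLp f g, hq.ae (coeFn_tensorLp g f)] with p h1 h2 h3 h4 h5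
  rw [h1, h2, h4, h5, Prod.fst_swap, Prod.snd_swap, h3, mul_comm (g p.2)]

theorem vanishesOffOrbit {w : I → I → ℝ} (hw : IsL2Kernel w)
    (hs : HasSimpleNonorthogonalSpectrum w) :
    VanishesOffOrbit (hilbertSchmidt (kernelLp hw.memLp)) oneLp := by
  refine .of_eigenvectors (isCompactOperator_hilbertSchmidt _) (isSymmetric_hilbertSchmidt hw)
    fun c φ hc hφ h => ?_
  have hne := hs.integral_ne_zero c φ hc
    ⟨Lp.memLp φ, fun h0 => hφ ((Lp.eq_zero_iff_ae_eq_zero).2 h0), by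
      refine (T_ae_eq_hilbertSchmidt hw.memLp φ).trans ?_
      rw [h]
      filter_upwards [Lp.coeFn_smul c φ] with u hu
      rw [hu]
      rfl⟩
  rw [L2.inner_def]
  convert hne using 1
  refine integral_congr_ae ?_
  filter_upwards [coeFn_oneLp] with u hu
  rw [hu]
  simp

theorem ae_eq_of_hilbertSchmidt_eq {w₁ w₂ : I → I → ℝ}
    (hw₁ : MemLp (fun p : I × I => w₁ p.1 p.2) 2) (hw₂ : MemLp (fun p : I × I => w₂ p.1 p.2) 2)
    (h : hilbertSchmidt (kernelLp hw₁) = hilbertSchmidt (kernelLp hw₂)) :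
    ∀ᵐ p : I × I, w₁ p.1 p.2 = w₂ p.1 p.2 := by
  have h' := hilbertSchmidt_injective h
  filter_upwards [coeFn_kernelLp hw₁, coeFn_kernelLp hw₂] with p h1 h2
  rw [← h1, ← h2, h']

theorem ae_eq_of_iterates_ae_eq {w₁ w₂ : I → I → ℝ}
    (hw₁ : MemLp (fun p : I × I => w₁ p.1 p.2) 2) (hw₂ : MemLp (fun p : I × I => w₂ p.1 p.2) 2)
    (hv₁ : VanishesOffOrbit (hilbertSchmidt (kernelLp hw₁)) oneLp)
    (hv₂ : VanishesOffOrbit (hilbertSchmidt (kernelLp hw₂)) oneLp)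
    (h : iterates w₁ =ᵐ[volume] iterates w₂) :
    ∀ᵐ p : I × I, w₁ p.1 p.2 = w₂ p.1 p.2 := by
  refine ae_eq_of_hilbertSchmidt_eq hw₁ hw₂ (hv₁.eq_of_orbit_eq hv₂ fun k => ?_)
  ext1
  refine (iterates_ae_eq hw₁ k).symm.trans (.trans ?_ (iterates_ae_eq hw₂ k))
  filter_upwards [h] with u hu
  rw [hu]

theorem iterates_ae_eq_of_ae_eq {w₁ w₂ : I → I → ℝ}
    (h : ∀ᵐ p : I × I, w₁ p.1 p.2 = w₂ p.1 p.2) :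
    iterates w₁ =ᵐ[volume] iterates w₂ := by
  have hT : ∀ f : I → ℝ, T w₁ f =ᵐ[volume] T w₂ f := fun f => by
    filter_upwards [Measure.ae_ae_of_ae_prod h] with u hu
    refine integral_congr_ae ?_
    filter_upwards [hu] with v hv
    rw [hv]
  have hk : ∀ k : ℕ, (T w₁)^[k] (fun _ => 1) =ᵐ[volume] (T w₂)^[k] (fun _ => 1) := fun k => by
    induction k with
    | zero => rfl
    | succ k ih =>
      rw [Function.iterate_succ_apply', Function.iterate_succ_apply', ← T_congr w₂ ih]
      exact hT _
  filter_upwards [ae_all_iff.2 fun k => hk (k + 1)] with u hu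
  exact funext hu

end KernelOperator

/-! ### Iterates and laws of pulled-back kernels. -/

section Pullback

variable {w : I → I → ℝ} {τ : I → I}

theorem memLp_pullback (hw : MemLp (fun p : I × I => w p.1 p.2) 2) (hτ : MeasurePreserving τ) :
    MemLp (fun p : I × I => w (τ p.1) (τ p.2)) 2 :=
  hw.comp_measurePreserving (hτ.prod hτ)

theorem kernelLp_pullback (hw : MemLp (fun p : I × I => w p.1 p.2) 2)
    (hτ : MeasurePreserving τ) :
    kernelLp (w := fun u v => w (τ u) (τ v)) (memLp_pullback hw hτ) =
      Lp.compMeasurePreserving (Prod.map τ τ) (hτ.prod hτ) (kernelLp hw) :=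
  (Lp.toLp_compMeasurePreserving hw (hτ.prod hτ)).symm

theorem oneLp_compMeasurePreserving (hτ : MeasurePreserving τ) :
    Lp.compMeasurePreservingₗᵢ ℝ τ hτ oneLp = oneLp := by
  ext1
  refine (Lp.coeFn_compMeasurePreserving oneLp hτ).trans (.trans ?_ coeFn_oneLp.symm)
  exact hτ.quasiMeasurePreserving.ae coeFn_oneLp

theorem vanishesOffOrbit_pullback (hw : MemLp (fun p : I × I => w p.1 p.2) 2)
    (hτ : MeasurePreserving τ)
    (hv : VanishesOffOrbit (hilbertSchmidt (kernelLp hw)) oneLp) :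
    VanishesOffOrbit (hilbertSchmidt
      (kernelLp (w := fun u v => w (τ u) (τ v)) (memLp_pullback hw hτ))) oneLp := by
  rw [kernelLp_pullback hw hτ, hilbertSchmidt_compMeasurePreserving hτ,
    ← oneLp_compMeasurePreserving hτ]
  exact hv.conj_isometry _

/-- The pulled-back operator is `C T C*`, where `C` is composition with `τ` and fixes `1`, so its
orbit of `1` is the image under `C` of the original one. -/
theorem iterates_pullback (hw : MemLp (fun p : I × I => w p.1 p.2) 2)
    (hτ : MeasurePreserving τ) :
    iterates (fun u v => w (τ u) (τ v)) =ᵐ[volume] iterates w ∘ τ := by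
  have hk : ∀ k : ℕ, (fun u => iterates (fun u v => w (τ u) (τ v)) u k) =ᵐ[volume]
      fun u => iterates w (τ u) k := fun k => by
    refine (iterates_ae_eq (memLp_pullback hw hτ) k).trans ?_
    rw [kernelLp_pullback hw hτ, hilbertSchmidt_compMeasurePreserving hτ]
    nth_rw 1 [← oneLp_compMeasurePreserving hτ]
    rw [iterate_conj_isometry]
    exact (Lp.coeFn_compMeasurePreserving _ hτ).trans
      (hτ.quasiMeasurePreserving.ae (iterates_ae_eq hw k).symm)
  filter_upwards [ae_all_iff.2 hk] with u hu
  exact funext hu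

theorem iteratesLaw_pullback (hw : MemLp (fun p : I × I => w p.1 p.2) 2)
    (hτ : MeasurePreserving τ) :
    iteratesLaw (fun u v => w (τ u) (τ v)) = iteratesLaw w := by
  rw [iteratesLaw, iteratesLaw, Measure.map_congr (iterates_pullback hw hτ),
    ← AEMeasurable.map_map_of_aemeasurable _ hτ.aemeasurable, hτ.map_eq]
  rw [hτ.map_eq]
  exact aemeasurable_iterates hw

end Pullback

theorem iteratesLaw_eq_of_ae_eq {w₁ w₂ : I → I → ℝ}
    (h : ∀ᵐ p : I × I, w₁ p.1 p.2 = w₂ p.1 p.2) : iteratesLaw w₁ = iteratesLaw w₂ :=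
  Measure.map_congr (iterates_ae_eq_of_ae_eq h)

end Graphon

namespace Graphon

/-! ### Coupling two random variables with the same law. -/

section Coupling

open ProbabilityTheory

variable {E : Type*} [MeasurableSpace E] [StandardBorelSpace E]

/-- A random variable on `I` can be resampled from its law and an independent uniform variable. -/
theorem exists_resampling {X : I → E} (hX : Measurable X) :
    ∃ f : E × I → I, MeasurePreserving f (((volume : Measure I).map X).prod volume) volume ∧
      ∀ᵐ p ∂((volume : Measure I).map X).prod volume, X (f p) = p.1 := by
  have : IsProbabilityMeasure ((volume : Measure I).map X) :=
    Measure.isProbabilityMeasure_map hX.aemeasurable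
  -- For each `x`, `f x` turns a uniform variable into a sample from the conditional law of `u`
  -- given `X u = x`. Hence `(x, f x s)` has the law of `(X u, u)`, which gives both conclusions.
  obtain ⟨f, hf, hfκ⟩ := (condDistrib id X (volume : Measure I)).exists_measurable_map_eq_unitInterval
  have hg : Measurable fun p : E × I => (p.1, f p.1 p.2) := measurable_fst.prodMk hf
  have hlaw : (((volume : Measure I).map X).prod volume).map (fun p : E × I => (p.1, f p.1 p.2)) =
      (volume : Measure I).map fun u => (X u, u) := by
    have h := compProd_map_condDistrib (mβ := ‹MeasurableSpace E›) (X := X) (Y := id) (μ := (volume : Measure I))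
      aemeasurable_id
    change _ = (volume : Measure I).map fun u => (X u, id u)
    rw [← h]
    ext s hs
    rw [Measure.map_apply hg hs, Measure.prod_apply (hg hs), Measure.compProd_apply hs]
    refine lintegral_congr fun x => ?_
    rw [← hfκ x, Measure.map_apply hf.of_uncurry_left (measurable_prodMk_left hs)]
    rfl
  refine ⟨fun p => f p.1 p.2, ⟨hf, ?_⟩, ?_⟩
  · have := congrArg (Measure.map Prod.snd) hlaw
    rw [Measure.map_map measurable_snd hg,
      Measure.map_map measurable_snd (hX.prodMk measurable_id')] at this
    exact this.trans Measure.map_id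
  · have hset : MeasurableSet {q : E × I | X q.2 = q.1} :=
      measurableSet_eq_fun (hX.comp measurable_snd) measurable_fst
    have h : ∀ᵐ q ∂(volume : Measure I).map fun u => (X u, u), X q.2 = q.1 :=
      (ae_map_iff (hX.prodMk measurable_id).aemeasurable hset).2 (.of_forall fun _ => rfl)
    rw [← hlaw] at h
    exact ae_of_ae_map hg.aemeasurable h

/-- Two random variables on `I` with the same law agree after measure-preserving
reparametrizations. -/
theorem exists_measurePreserving_comp_eq [Nonempty E] {X Y : I → E} (hX : AEMeasurable X) (hY : AEMeasurable Y)
    (h : (volume : Measure I).map X = (volume : Measure I).map Y) :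
    ∃ τ₁ τ₂ : I → I, MeasurePreserving τ₁ ∧ MeasurePreserving τ₂ ∧
      X ∘ τ₁ =ᵐ[volume] Y ∘ τ₂ := by
  rw [Measure.map_congr hX.ae_eq_mk, Measure.map_congr hY.ae_eq_mk] at h
  obtain ⟨f, hf, hfX⟩ := exists_resampling hX.measurable_mk
  obtain ⟨g, hg, hgY⟩ := exists_resampling hY.measurable_mk
  rw [← h] at hg hgY
  have : IsProbabilityMeasure ((volume : Measure I).map (hX.mk X)) :=
    Measure.isProbabilityMeasure_map hX.measurable_mk.aemeasurable
  -- Realizing the product law on `I` itself gives both resamplings a common domain, with the same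
  -- value `x` fed to each.
  obtain ⟨e, he, hemap⟩ :=
    (((volume : Measure I).map (hX.mk X)).prod (volume : Measure I)).exists_measurable_map_eq
  have he' : MeasurePreserving e volume _ := ⟨he, hemap⟩
  refine ⟨f ∘ e, g ∘ e, hf.comp he', hg.comp he', ?_⟩
  filter_upwards [he'.quasiMeasurePreserving.ae hfX, he'.quasiMeasurePreserving.ae hgY,
    (hf.comp he').quasiMeasurePreserving.ae hX.ae_eq_mk,
    (hg.comp he').quasiMeasurePreserving.ae hY.ae_eq_mk] with u h1 h2 h3 h4
  simp only [Function.comp_apply] at h3 h4 ⊢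
  rw [h3, h4, h1, h2]

end Coupling

theorem equivalent_iff_iteratesLaw_eq {w₁ w₂ : I → I → ℝ} (hw₁ : IsL2Kernel w₁)
    (hw₂ : IsL2Kernel w₂) (hs₁ : HasSimpleNonorthogonalSpectrum w₁)
    (hs₂ : HasSimpleNonorthogonalSpectrum w₂) :
    iteratesLaw w₁ = iteratesLaw w₂ ↔ Equivalent w₁ w₂ := by
  constructor
  · intro h
    obtain ⟨τ₁, τ₂, h₁, h₂, h12⟩ := exists_measurePreserving_comp_eq
      (aemeasurable_iterates hw₁.memLp) (aemeasurable_iterates hw₂.memLp) h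
    refine ⟨τ₁, τ₂, h₁, h₂, ?_⟩
    exact ae_eq_of_iterates_ae_eq (memLp_pullback hw₁.memLp h₁) (memLp_pullback hw₂.memLp h₂)
      (vanishesOffOrbit_pullback hw₁.memLp h₁ (vanishesOffOrbit hw₁ hs₁))
      (vanishesOffOrbit_pullback hw₂.memLp h₂ (vanishesOffOrbit hw₂ hs₂))
      ((iterates_pullback hw₁.memLp h₁).trans
        (h12.trans (iterates_pullback hw₂.memLp h₂).symm))
  · rintro ⟨τ₁, τ₂, h₁, h₂, h⟩
    rw [← iteratesLaw_pullback hw₁.memLp h₁, ← iteratesLaw_pullback hw₂.memLp h₂]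
    exact iteratesLaw_eq_of_ae_eq h

end Graphon

namespace Graphon

/-! ### Nondecreasing maps are determined by their law. -/

section Rearrangement

variable {S : Set I}

theorem measureReal_le_of_subset_Iio (hS : volume Sᶜ = 0) {A : Set I} {u : I}
    (h : ∀ v ∈ A, v ∈ S → v < u) : volume.real A ≤ u := by
  have h1 : volume.real A ≤ volume.real (Set.Iio u) := by
    refine ENNReal.toReal_mono (measure_ne_top _ _) (measure_mono_ae ?_)
    have hS' : ∀ᵐ v, v ∈ S := hS
    filter_upwards [hS'] with v hv hvA using h v hvA hv
  refine h1.trans_eq ?_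
  rw [measureReal_def, volume_Iio, ENNReal.toReal_ofReal u.2.1]

theorem le_measureReal_of_Iic_subset (hS : volume Sᶜ = 0) {A : Set I} {u : I}
    (h : ∀ v ≤ u, v ∈ S → v ∈ A) : (u : ℝ) ≤ volume.real A := by
  have h1 : volume.real (Set.Iic u) ≤ volume.real A := by
    refine ENNReal.toReal_mono (measure_ne_top _ _) (measure_mono_ae ?_)
    have hS' : ∀ᵐ v, v ∈ S := hS
    filter_upwards [hS'] with v hv hvA using h v hvA hv
  refine le_trans (le_of_eq ?_) h1
  rw [measureReal_def, volume_Iic, ENNReal.toReal_ofReal u.2.1]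

/-- Almost everywhere nondecreasing real functions on `[0,1]` are determined by their law. -/
theorem ae_eq_of_monotoneOn_real (hS : volume Sᶜ = 0) {f g : I → ℝ} (hf : Measurable f)
    (hg : Measurable g) (hfS : MonotoneOn f S) (hgS : MonotoneOn g S)
    (h : (volume : Measure I).map f = (volume : Measure I).map g) : f =ᵐ[volume] g := by
  have hS' : ∀ᵐ v, v ∈ S := hS
  have key : ∀ q : ℚ, ∀ᵐ u : I, (f u < q ↔ g u < q) := by
    intro q
    have hAm : MeasurableSet {u | f u < q} := measurableSet_lt hf measurable_const
    have hBm : MeasurableSet {u | g u < q} := measurableSet_lt hg measurable_const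
    have hm : volume {u | f u < q} = volume {u | g u < q} := by
      have := congrArg (fun ν => ν (Set.Iio (q : ℝ))) h
      simp only [Measure.map_apply hf measurableSet_Iio,
        Measure.map_apply hg measurableSet_Iio] at this
      exact this
    have hAB : {u | f u < q} =ᵐ[volume] {u | g u < q} := by
      -- Within `S` both sublevel sets are initial segments, so one contains the other; equal
      -- measures then force equality almost everywhere.
      by_cases hsub : ∀ u ∈ S, f u < q → g u < q
      · refine ae_eq_of_ae_subset_of_measure_ge ?_ hm.ge hAm.nullMeasurableSet
          (measure_ne_top _ _)
        filter_upwards [hS'] with u hu h1 using hsub u hu h1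
      · push Not at hsub
        obtain ⟨u, hu, hfu, hgu⟩ := hsub
        refine (ae_eq_of_ae_subset_of_measure_ge ?_ hm.le hBm.nullMeasurableSet
          (measure_ne_top _ _)).symm
        filter_upwards [hS'] with v hv (hgv : g v < q)
        have hvu : v ≤ u := le_of_not_ge fun huv => absurd (hgS hu hv huv) (by linarith)
        exact (hfS hv hu hvu).trans_lt hfu
    filter_upwards [hAB.mem_iff] with u hu using hu
  filter_upwards [ae_all_iff.2 key] with u hu
  refine le_antisymm (le_of_not_gt fun hlt => ?_) (le_of_not_gt fun hlt => ?_)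
  · obtain ⟨q, h1, h2⟩ := exists_rat_btwn hlt
    exact absurd ((hu q).2 h1) h2.not_gt
  · obtain ⟨q, h1, h2⟩ := exists_rat_btwn hlt
    exact absurd ((hu q).1 h1) h2.not_gt

variable {L : Type*} [MeasurableSpace L] [LinearOrder L]

/-- Almost everywhere nondecreasing functions from `[0,1]` to a linear order with measurable order
relation are determined by their law. -/
theorem ae_eq_of_monotoneOn (hlt : MeasurableSet {p : L × L | p.1 < p.2}) (hS : volume Sᶜ = 0)
    {X Y : I → L} (hX : Measurable X) (hY : Measurable Y) (hXS : MonotoneOn X S)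
    (hYS : MonotoneOn Y S)
    (h : (volume : Measure I).map X = (volume : Measure I).map Y) : X =ᵐ[volume] Y := by
  have hS' : ∀ᵐ v, v ∈ S := hS
  -- Up to a null set, `{X = x}` is the interval from `a x` to `b x`. Both endpoints are monotone in
  -- `x`, so the real case applies to `a ∘ X`, `a ∘ Y` and to `b ∘ X`, `b ∘ Y`.
  let a : L → ℝ := fun x => volume.real {v | X v < x}
  let b : L → ℝ := fun x => volume.real {v | X v ≤ x}
  have hgt : MeasurableSet {p : L × L | p.2 < p.1} := measurable_swap hlt
  have hle : MeasurableSet {p : L × L | p.1 ≤ p.2} := by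
    convert hgt.compl using 1
    ext p
    simp
  have heq : MeasurableSet {p : L × L | p.1 = p.2} := by
    convert hle.inter (measurable_swap hle) using 1
    ext p
    exact le_antisymm_iff
  have hpair : Measurable fun p : L × I => (X p.2, p.1) :=
    (hX.comp measurable_snd).prodMk measurable_fst
  have ha : Measurable a := (measurable_measure_prodMk_left (hpair hlt)).ennreal_toReal
  have hb : Measurable b := (measurable_measure_prodMk_left (hpair hle)).ennreal_toReal
  have ha_mono : Monotone a := fun x y hxy =>
    measureReal_mono fun v (hv : X v < x) => hv.trans_le hxy
  have hb_mono : Monotone b := fun x y hxy =>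
    measureReal_mono fun v (hv : X v ≤ x) => hv.trans hxy
  have hab : ∀ x, a x ≤ b x := fun x => measureReal_mono fun v (hv : X v < x) => hv.le
  have ha01 : ∀ x, a x ∈ Set.Icc (0 : ℝ) 1 := fun x => ⟨measureReal_nonneg, measureReal_le_one⟩
  have hmap : ∀ {c : L → ℝ}, Measurable c →
      (volume : Measure I).map (c ∘ X) = (volume : Measure I).map (c ∘ Y) := fun hc => by
    rw [← Measure.map_map hc hX, ← Measure.map_map hc hY, h]
  have haXY := ae_eq_of_monotoneOn_real hS (ha.comp hX) (ha.comp hY)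
    (ha_mono.comp_monotoneOn hXS) (ha_mono.comp_monotoneOn hYS) (hmap ha)
  have hbXY := ae_eq_of_monotoneOn_real hS (hb.comp hX) (hb.comp hY)
    (hb_mono.comp_monotoneOn hXS) (hb_mono.comp_monotoneOn hYS) (hmap hb)
  let loc : L → I := fun x => ⟨a x, ha01 x⟩
  have hloc : Measurable loc := ha.subtype_mk
  -- `P x` says that `x` can be read off from `X` and its endpoints: at the single point `a x` if
  -- they coincide, almost everywhere between them otherwise. Being measurable, `P` passes from the
  -- values of `X` to those of `Y` through the common law.
  let P : L → Prop := fun x => (a x = b x → X (loc x) = x) ∧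
    ∀ᵐ s : I, a x < s → (s : ℝ) < b x → X s = x
  have hPm : MeasurableSet {x | P x} := by
    refine MeasurableSet.inter ?_ ?_
    · refine MeasurableSet.imp (measurableSet_eq_fun ha hb) ?_
      exact ((hX.comp hloc).prodMk measurable_id) heq
    · have hB : MeasurableSet {p : L × I |
          ¬ (a p.1 < p.2 → (p.2 : ℝ) < b p.1 → X p.2 = p.1)} := by
        refine MeasurableSet.compl (MeasurableSet.imp ?_ (MeasurableSet.imp ?_ (hpair heq)))
        · exact measurableSet_lt (ha.comp measurable_fst) measurable_snd.subtype_val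
        · exact measurableSet_lt measurable_snd.subtype_val (hb.comp measurable_fst)
      exact measurable_measure_prodMk_left hB (measurableSet_singleton 0)
  have hPX : ∀ᵐ u, P (X u) := by
    filter_upwards [hS'] with u hu
    have h1 : a (X u) ≤ u := measureReal_le_of_subset_Iio hS fun v (hv : X v < X u) hvS =>
      lt_of_not_ge fun huv => hv.not_ge (hXS hu hvS huv)
    have h2 : u ≤ b (X u) := le_measureReal_of_Iic_subset hS fun v hv hvS => hXS hvS hu hv
    refine ⟨fun hab => ?_, ?_⟩
    · have : loc (X u) = u := Subtype.ext (le_antisymm h1 (h2.trans hab.ge))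
      rw [this]
    · filter_upwards [hS'] with s hs h3 h4
      rcases lt_trichotomy (X s) (X u) with hlt | heq | hgt
      · exact absurd (le_measureReal_of_Iic_subset hS (A := {v | X v < X u})
          fun v hv hvS => (hXS hvS hs hv).trans_lt hlt) h3.not_ge
      · exact heq
      · exact absurd (measureReal_le_of_subset_Iio hS (A := {v | X v ≤ X u})
          fun v hv hvS => lt_of_not_ge fun hsv => (hgt.trans_le (hXS hs hvS hsv)).not_ge hv)
          h4.not_ge
  have hPY : ∀ᵐ u, P (Y u) := by
    have := (ae_map_iff hX.aemeasurable hPm).2 hPX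
    rw [h] at this
    exact (ae_map_iff hY.aemeasurable hPm).1 this
  filter_upwards [hPX, hPY, haXY, hbXY] with u hXu hYu hau hbu
  simp only [Function.comp_apply] at hau hbu
  rcases (hab (X u)).eq_or_lt with he | hl
  · rw [← hXu.1 he, ← hYu.1 (by rw [← hau, ← hbu, he])]
    exact congrArg X (Subtype.ext hau)
  · have h1 := hXu.2
    have h2 := hYu.2
    rw [← hau, ← hbu] at h2
    by_contra hne
    -- On this interval `X` equals both `X u` and `Y u` almost everywhere; if these differed, the
    -- interval would be null despite its positive length.
    have hnone : ∀ᵐ s : I, ¬ (a (X u) < s ∧ (s : ℝ) < b (X u)) := by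
      filter_upwards [h1, h2] with s hs1 hs2 hs
      exact hne ((hs1 hs.1 hs.2).symm.trans (hs2 hs.1 hs.2))
    have hb1 : b (X u) ≤ 1 := measureReal_le_one
    have hpos : volume (Set.Ioo (loc (X u)) ⟨b (X u), (ha01 _).1.trans (hab _), hb1⟩) = 0 := by
      refine measure_mono_null (fun s hs => ?_) hnone
      exact not_not.2 ⟨hs.1, hs.2⟩
    rw [volume_Ioo, ENNReal.ofReal_eq_zero] at hpos
    exact absurd hpos (not_le.2 (sub_pos.2 hl))

end Rearrangement

/-- A countable union over the first index where the sequences differ. -/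
theorem measurableSet_toLex_lt :
    MeasurableSet {p : (ℕ → ℝ) × (ℕ → ℝ) | toLex p.1 < toLex p.2} := by
  have : {p : (ℕ → ℝ) × (ℕ → ℝ) | toLex p.1 < toLex p.2} =
      ⋃ i : ℕ, (⋂ j : ℕ, ⋂ _ : j < i, {p | p.1 j = p.2 j}) ∩ {p | p.1 i < p.2 i} := by
    ext p
    simp only [Set.mem_iUnion, Set.mem_inter_iff, Set.mem_iInter]
    exact Iff.rfl
  rw [this]
  refine .iUnion fun i => .inter (.iInter fun j => .iInter fun _ => ?_) ?_
  · exact measurableSet_eq_fun (by fun_prop) (by fun_prop)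
  · exact measurableSet_lt (by fun_prop) (by fun_prop)

theorem iterates_ae_eq_of_isCanonical {w₁ w₂ : I → I → ℝ}
    (hw₁ : AEMeasurable (iterates w₁)) (hw₂ : AEMeasurable (iterates w₂))
    (hc₁ : IsCanonical w₁) (hc₂ : IsCanonical w₂) (h : iteratesLaw w₁ = iteratesLaw w₂) :
    iterates w₁ =ᵐ[volume] iterates w₂ := by
  obtain ⟨S₁, hS₁, hm₁⟩ := hc₁
  obtain ⟨S₂, hS₂, hm₂⟩ := hc₂
  -- The iterates are only almost everywhere measurable, so monotonicity is passed to measurable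
  -- representatives on a smaller conull set.
  let S : Set I := (S₁ ∩ {u | iterates w₁ u = hw₁.mk _ u}) ∩ (S₂ ∩ {u | iterates w₂ u = hw₂.mk _ u})
  have hS : volume Sᶜ = 0 := by
    have h1 : ∀ᵐ u, u ∈ S₁ := hS₁
    have h2 : ∀ᵐ u, u ∈ S₂ := hS₂
    have h3 : ∀ᵐ u, u ∈ S := by
      filter_upwards [h1, h2, hw₁.ae_eq_mk, hw₂.ae_eq_mk] with u h1 h2 h3 h4
      exact ⟨⟨h1, h3⟩, ⟨h2, h4⟩⟩
    exact h3
  rw [iteratesLaw, iteratesLaw, Measure.map_congr hw₁.ae_eq_mk, Measure.map_congr hw₂.ae_eq_mk] at h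
  refine hw₁.ae_eq_mk.trans (.trans ?_ hw₂.ae_eq_mk.symm)
  let _ : MeasurableSpace (Lex (ℕ → ℝ)) := inferInstanceAs (MeasurableSpace (ℕ → ℝ))
  refine ae_eq_of_monotoneOn (L := Lex (ℕ → ℝ)) (S := S) measurableSet_toLex_lt hS
    hw₁.measurable_mk hw₂.measurable_mk ?_ ?_ h
  · intro u hu v hv huv
    have := hm₁ hu.1.1 hv.1.1 huv
    rwa [← show _ = hw₁.mk _ u from hu.1.2, ← show _ = hw₁.mk _ v from hv.1.2]
  · intro u hu v hv huv
    have := hm₂ hu.2.1 hv.2.1 huv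
    rwa [← show _ = hw₂.mk _ u from hu.2.2, ← show _ = hw₂.mk _ v from hv.2.2]

end Graphon

theorem theorem3 (w₁ w₂ : I → I → ℝ)
    (hw₁ : Graphon.IsL2Kernel w₁) (hw₂ : Graphon.IsL2Kernel w₂)
    (hs₁ : Graphon.HasSimpleNonorthogonalSpectrum w₁)
    (hs₂ : Graphon.HasSimpleNonorthogonalSpectrum w₂) :
    (Graphon.IsCanonical w₁ → Graphon.IsCanonical w₂ →
      (Graphon.iteratesLaw w₁ = Graphon.iteratesLaw w₂ ↔
        ∀ᵐ p : I × I, w₁ p.1 p.2 = w₂ p.1 p.2)) ∧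
    (Graphon.iteratesLaw w₁ = Graphon.iteratesLaw w₂ ↔ Graphon.Equivalent w₁ w₂) := by
  refine ⟨fun hc₁ hc₂ => ⟨fun h => ?_, Graphon.iteratesLaw_eq_of_ae_eq⟩,
    Graphon.equivalent_iff_iteratesLaw_eq hw₁ hw₂ hs₁ hs₂⟩
  exact Graphon.ae_eq_of_iterates_ae_eq hw₁.memLp hw₂.memLp
    (Graphon.vanishesOffOrbit hw₁ hs₁) (Graphon.vanishesOffOrbit hw₂ hs₂)
    (Graphon.iterates_ae_eq_of_isCanonical (Graphon.aemeasurable_iterates hw₁.memLp)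
      (Graphon.aemeasurable_iterates hw₂.memLp) hc₁ hc₂ h)
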